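/- For a finite group $G$ let $d(G)$ denote the minimal number of generators of $G$, and let $\mathrm{rk}(G) := \sup\{ d(H) \mid H \le G \}$, where $H$ ranges over all subgroups of $G$. For an integer $c \ge 3$ let $$\mathrm{SD}_{2^{c+1}} = \langle x, y \mid x^2 = y^{2^c} = 1,\; x^{-1} y x = y^{-(1+2^{c-1})} \rangle$$ be the semidihedral group of order $2^{c+1}$. For an integer $r \ge 0$ let $W_r(2) = C_2 \wr \cdots \wr C_2$ be the $r$-fold iterated permutational wreath product of cyclic groups of order $2$, a permutation group of degree $2^r$ (with $W_0(2)$ trivial), and let $Y_{c,r} := \mathrm{SD}_{2^{c+1}} \wr W_r(2) = (\mathrm{SD}_{2^{c+1}})^{2^r} \rtimes W_r(2)$ be the permutational wreath product in which $W_r(2)$ permutes the $2^r$ factors of the base group. Then, for all integers $c \ge 3$ and $r \ge 0$, $$\mathrm{rk}(Y_{c,r}) = 2^{r+1}.$$ -/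

import Mathlib

/-- The minimal number of generators `d(G)` of a group `G`, as an element of `ℕ∞`. -/
noncomputable def minGenerators (G : Type*) [Group G] : ℕ∞ :=
  ⨅ (S : Set G) (_ : Subgroup.closure S = ⊤), S.encard

/-- The rank `rk(G) = sup {d(H) | H ≤ G}` of a group `G`, as an element of `ℕ∞`.
For a finite group, regarded as a discrete profinite group, every subgroup is closed and
topological generation is generation, so this is the rank of the profinite group. -/
noncomputable def subgroupRank (G : Type*) [Group G] : ℕ∞ :=
  ⨆ H : Subgroup G, minGenerators H

/-- The two generators of the semidihedral group. -/
inductive SDGen : Type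
  | x
  | y

/-- The relators of the presentation
`⟨x, y | x² = y^(2^c) = 1, x⁻¹ y x = y^(-(1 + 2^(c-1)))⟩`. -/
def semidihedralRels (c : ℕ) : Set (FreeGroup SDGen) :=
  let x : FreeGroup SDGen := FreeGroup.of SDGen.x
  let y : FreeGroup SDGen := FreeGroup.of SDGen.y
  {x ^ 2, y ^ (2 ^ c), x⁻¹ * y * x * (y ^ (-(1 + 2 ^ (c - 1) : ℤ)))⁻¹}

/-- The semidihedral group of order `2^(c+1)`; only meant for `c ≥ 3`. -/
abbrev Semidihedral (c : ℕ) : Type := PresentedGroup (semidihedralRels c)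

/-- The permutational wreath product `D ≀ Q = D^Ω ⋊ Q` of a group `D` with a group `Q` that
acts on the set `Ω` through `ρ`; the action on the base group `D^Ω` is
`(q • f) ω = f (ρ(q)⁻¹ ω)`. -/
abbrev PermWreathProduct (D Q Ω : Type*) [Group D] [Group Q] (ρ : Q →* Equiv.Perm Ω) : Type _ :=
  (Ω → D) ⋊[(mulAutArrow (G := Equiv.Perm Ω) (A := Ω) (M := D)).comp ρ] Q

/-- The `r`-fold iterated wreath product `W_r(2) = C₂ ≀ ⋯ ≀ C₂`. -/
abbrev WTwo (r : ℕ) : Type := IteratedWreathProduct (Multiplicative (ZMod 2)) r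

/-- The group `Y_{c,r} = SD_{2^(c+1)} ≀ W_r(2)`, where `W_r(2)` acts in the natural way
as a permutation group of degree `2^r`, here on the set `Fin r → C₂`. -/
abbrev YGroup (c r : ℕ) : Type :=
  PermWreathProduct (Semidihedral c) (WTwo r) (Fin r → Multiplicative (ZMod 2))
    (iteratedWreathToPermHom (Multiplicative (ZMod 2)) r)

/-! Lower bound: the base group of the wreath product maps onto an `F_2`-space of dimension `2 * 2 ^
r`.

Upper bound: bounding `d(H)` alone does not survive the induction. For `H` in `A ≀ C_2` not inside
the base, adding the bounds for the two coordinates and for an element swapping them gives one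
generator too many. The induction therefore also carries a bound for normal subgroups inside the
Frattini subgroup, described for a 2-group as the common kernel of all homomorphisms to `ℤˣ`: these
need one generator fewer. This is `RankGood`, and passing from `A` to `A ≀ C_2` turns `m` into `2 *
m + 1`, so `m + 1` doubles (`HereditarilyRankGood.step`). The saved generator comes from
`GenBy.exchange`, the Frattini bound from `exists_sign_transfer`. The induction starts at the
semidihedral group with `m = 1`. -/

/-- `H` is generated by at most `n` elements. -/
def GenBy {G : Type*} [Group G] (n : ℕ) (H : Subgroup G) : Prop :=
  ∃ S : Finset G, S.card ≤ n ∧ Subgroup.closure (S : Set G) = H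

/-- `G` is generated by `m + 1` elements, and every normal subgroup that is killed by all
homomorphisms to `{1, -1}` is generated by `m` elements. -/
def RankGood (m : ℕ) (G : Type*) [Group G] : Prop :=
  GenBy (m + 1) (⊤ : Subgroup G) ∧ ∀ K : Subgroup G, K.Normal →
    (∀ f : G →* ℤˣ, ∀ k ∈ K, f k = 1) → GenBy m K

/-- All subgroups of `G` are `RankGood m`. -/
def HereditarilyRankGood (m : ℕ) (G : Type*) [Group G] : Prop :=
  ∀ H : Subgroup G, RankGood m H

/-! ### Counting generators through homomorphisms -/

section GenBy

variable {G G' : Type*} [Group G] [Group G']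

theorem GenBy.mono {a b : ℕ} {H : Subgroup G} (h : GenBy a H) (hab : a ≤ b) : GenBy b H := by
  obtain ⟨S, hS, hc⟩ := h
  exact ⟨S, hS.trans hab, hc⟩

theorem GenBy.map {n : ℕ} {H : Subgroup G} (h : GenBy n H) (f : G →* G') :
    GenBy n (H.map f) := by
  classical
  obtain ⟨S, hS, rfl⟩ := h
  refine ⟨S.image f, Finset.card_image_le.trans hS, ?_⟩
  rw [MonoidHom.map_closure, Finset.coe_image]

/-- Generators of an image lift. -/
theorem exists_finset_lift (f : G →* G') (H : Subgroup G) (S' : Finset G')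
    (hS' : (S' : Set G') ⊆ H.map f) :
    ∃ S : Finset G, S.card ≤ S'.card ∧ (S : Set G) ⊆ H ∧ f '' (S : Set G) = S' := by
  classical
  have h : ∀ s : S', ∃ g ∈ H, f g = s := fun s => Subgroup.mem_map.1 (hS' s.2)
  choose g hg hfg using h
  refine ⟨Finset.univ.image g, Finset.card_image_le.trans (by simp), ?_, ?_⟩
  · simpa [Set.range_subset_iff] using fun a ha => hg ⟨a, ha⟩
  · ext x
    constructor
    · rintro ⟨y, hy, rfl⟩
      simp only [Finset.coe_image, Finset.coe_univ, Set.image_univ, Set.mem_range] at hy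
      obtain ⟨s, rfl⟩ := hy
      rw [hfg]
      exact s.2
    · intro hx
      exact ⟨g ⟨x, hx⟩, by simp, hfg _⟩

theorem le_of_map_le_of_inf_ker_le {f : G →* G'} {H K : Subgroup G} (hKH : K ≤ H)
    (h1 : H.map f ≤ K.map f) (h2 : H ⊓ f.ker ≤ K) : H ≤ K := by
  intro x hx
  obtain ⟨y, hy, hyx⟩ := Subgroup.mem_map.1 (h1 (Subgroup.mem_map_of_mem f hx))
  have h3 : y⁻¹ * x ∈ K := h2 ⟨H.mul_mem (H.inv_mem (hKH hy)) hx, MonoidHom.mem_ker.2 <| by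
    rw [map_mul, map_inv, hyx, inv_mul_cancel]⟩
  simpa using K.mul_mem hy h3

theorem GenBy.of_map_of_inf_ker {a b : ℕ} (f : G →* G') {H : Subgroup G}
    (h1 : GenBy a (H.map f)) (h2 : GenBy b (H ⊓ f.ker)) : GenBy (a + b) H := by
  classical
  obtain ⟨S', hS', hc'⟩ := h1
  obtain ⟨T, hT, hcT⟩ := h2
  obtain ⟨S, hS, hSH, hfS⟩ := exists_finset_lift f H S' (hc' ▸ Subgroup.subset_closure)
  have hle : Subgroup.closure ((S ∪ T : Finset G) : Set G) ≤ H := by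
    rw [Finset.coe_union, Subgroup.closure_union, hcT]
    exact sup_le ((Subgroup.closure_le _).2 hSH) inf_le_left
  refine ⟨S ∪ T, (Finset.card_union_le _ _).trans (add_le_add (hS.trans hS') hT),
    le_antisymm hle (le_of_map_le_of_inf_ker_le (f := f) hle ?_ ?_)⟩
  · rw [← hc', MonoidHom.map_closure, ← hfS]
    exact Subgroup.closure_mono (Set.image_mono (by simp))
  · rw [← hcT]
    exact Subgroup.closure_mono (by simp)

theorem genBy_bot : GenBy 0 (⊥ : Subgroup G) := ⟨∅, by simp, by simp⟩

theorem GenBy.of_map {a : ℕ} (f : G →* G') {H : Subgroup G}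
    (h1 : GenBy a (H.map f)) (h2 : ∀ x ∈ H, f x = 1 → x = 1) : GenBy a H := by
  refine h1.of_map_of_inf_ker f (b := 0) ?_
  have : H ⊓ f.ker = ⊥ := by
    rw [eq_bot_iff]
    rintro x ⟨hx, hx'⟩
    exact h2 x hx hx'
  rw [this]
  exact genBy_bot

theorem HereditarilyRankGood.genBy {m : ℕ} (h : HereditarilyRankGood m G) (H : Subgroup G) :
    GenBy (m + 1) H := by
  simpa [← MonoidHom.range_eq_map] using (h H).1.map H.subtype

/-- A normal subgroup `K` whose image under `p` is killed by all signs of the image of `p`. -/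
theorem HereditarilyRankGood.genBy_map {m : ℕ} (h : HereditarilyRankGood m G) (p : G' →* G)
    (K : Subgroup G') (hK : K.Normal)
    (hf : ∀ f : p.range →* ℤˣ, ∀ k ∈ K, f (p.rangeRestrict k) = 1) :
    GenBy m (K.map p) := by
  have h1 := (h p.range).2 (K.map p.rangeRestrict)
    (hK.map _ p.rangeRestrict_surjective) (by
      rintro f _ ⟨k, hk, rfl⟩
      exact hf f k hk)
  have h2 := h1.map p.range.subtype
  rwa [Subgroup.map_map, MonoidHom.subtype_comp_rangeRestrict] at h2

end GenBy

/-! ### Signs and the Frattini quotient of a finite 2-group -/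

section TwoGroups

variable {G : Type*} [Group G]

/-- The sign homomorphism of a subgroup of index two. -/
theorem exists_sign_of_index_two {M : Subgroup G} (hM : M.index = 2) :
    ∃ f : G →* ℤˣ, ∀ g, f g = 1 ↔ g ∈ M := by
  classical
  refine ⟨⟨⟨fun g => if g ∈ M then 1 else -1, by simp [M.one_mem]⟩, fun a b => ?_⟩, fun g => ?_⟩
  · have := Subgroup.mul_mem_iff_of_index_two hM (a := a) (b := b)
    by_cases ha : a ∈ M <;> by_cases hb : b ∈ M <;> simp [this, ha, hb]
  · by_cases hg : g ∈ M <;> simp [hg]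

/-- In a finite 2-group every proper subgroup lies in one of index two. Hence signs detect
generation. -/
theorem exists_sign_of_ne_top [Finite G] (hG : IsPGroup 2 G) {H : Subgroup G} (hH : H ≠ ⊤) :
    ∃ f : G →* ℤˣ, (∀ x ∈ H, f x = 1) ∧ ∃ g, f g ≠ 1 := by
  have : Fact (Nat.Prime 2) := ⟨Nat.prime_two⟩
  obtain ⟨n, hn⟩ := IsPGroup.iff_card.1 hG
  obtain ⟨k, hk⟩ := IsPGroup.iff_card.1 (hG.to_subgroup H)
  have hlt : Nat.card H < Nat.card G := by
    refine lt_of_le_of_ne (Subgroup.card_le_card_group H) fun h => hH (Subgroup.eq_top_of_card_eq H h)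
  rw [hn, hk] at hlt
  have hkn : k < n := (Nat.pow_lt_pow_iff_right (by norm_num)).1 hlt
  obtain ⟨j, rfl⟩ : ∃ j, n = j + 1 := ⟨n - 1, by omega⟩
  obtain ⟨M, hM, hHM⟩ := Sylow.exists_subgroup_card_pow_prime_le 2 (G := G) (n := k) (m := j)
    (by rw [hn]; exact pow_dvd_pow _ (by omega)) H hk (by omega)
  have hidx : M.index = 2 := by
    have := M.card_mul_index
    rw [hM, hn, pow_succ] at this
    exact Nat.eq_of_mul_eq_mul_left (by positivity) this
  obtain ⟨f, hf⟩ := exists_sign_of_index_two hidx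
  refine ⟨f, fun x hx => (hf x).2 (hHM hx), ?_⟩
  by_contra! hcon
  have : M = ⊤ := by
    rw [eq_top_iff]
    exact fun x _ => (hf x).1 (hcon x)
  rw [this, Subgroup.index_top] at hidx
  omega

/-- An element outside the Frattini subgroup can be exchanged into a generating set. -/
theorem GenBy.exchange [Finite G] (hG : IsPGroup 2 G) {n : ℕ} (h : GenBy (n + 1) (⊤ : Subgroup G))
    (k : G) (f : G →* ℤˣ) (hk : f k ≠ 1) :
    ∃ S : Finset G, S.card ≤ n ∧ Subgroup.closure (insert k (S : Set G)) = ⊤ := by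
  classical
  obtain ⟨S, hS, hc⟩ := h
  by_contra! hcon
  have hcard : ∀ s ∈ S, (S.erase s).card ≤ n := fun s hs => by
    have := Finset.card_erase_of_mem hs
    omega
  -- If `k` can replace no `s`, signs separate each `s` from `k` and from the other generators: the
  -- `φ s` form a dual basis to `S` that vanishes at `k`. Every sign is a product of them, so `f k =
  -- 1`.
  have key : ∀ s : G, ∃ φ : G →* ℤˣ, s ∈ S → φ k = 1 ∧ (∀ t ∈ S, t ≠ s → φ t = 1) ∧ φ s = -1 := by
    intro s
    by_cases hs : s ∈ S
    swap
    · exact ⟨1, fun h => (hs h).elim⟩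
    obtain ⟨φ, hφ, g, hg⟩ := exists_sign_of_ne_top hG (hcon (S.erase s) (hcard s hs))
    have h1 : ∀ t ∈ S, t ≠ s → φ t = 1 := fun t ht hts =>
      hφ t (Subgroup.subset_closure (by simp [ht, hts]))
    refine ⟨φ, fun _ => ⟨hφ k (Subgroup.subset_closure (by simp)), h1, ?_⟩⟩
    rcases Int.units_eq_one_or (φ s) with h2 | h2
    · exfalso
      apply hg
      have : φ = 1 := MonoidHom.eq_of_eqOn_dense hc fun t ht => by
        by_cases hts : t = s
        · rw [hts, h2]; rfl
        · exact h1 t ht hts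
      rw [this]; rfl
    · exact h2
  choose φ hφ using key
  have hf : f = ∏ s ∈ S.filter (fun s => f s = -1), φ s :=
    MonoidHom.eq_of_eqOn_dense hc fun t ht => by
      rw [MonoidHom.finsetProd_apply]
      by_cases h1 : f t = -1
      · rw [Finset.prod_eq_single t]
        · rw [h1, (hφ t ht).2.2]
        · intro s hs hst
          exact (hφ s (Finset.mem_filter.1 hs).1).2.1 t ht hst.symm
        · intro h; exact (h (Finset.mem_filter.2 ⟨ht, h1⟩)).elim
      · rw [(Int.units_eq_one_or (f t)).resolve_right h1, Finset.prod_eq_one]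
        intro s hs
        refine (hφ s (Finset.mem_filter.1 hs).1).2.1 t ht ?_
        rintro rfl
        exact h1 (Finset.mem_filter.1 hs).2
  apply hk
  rw [hf, MonoidHom.finsetProd_apply]
  exact Finset.prod_eq_one fun s hs => (hφ s (Finset.mem_filter.1 hs).1).1

end TwoGroups

/-! ### Extending signs from a subgroup of index two -/

section Extension

variable {G : Type*} [Group G]

/-- The extension takes the value `1` at `h`; invariance under `h` and triviality at `h * h` make it
multiplicative. -/
theorem exists_sign_extension {N : Subgroup G} [hN : N.Normal] (hi : N.index = 2) {h : G}
    (hh : h ∉ N) (ψ : N →* ℤˣ) (hc : ∀ x, ψ (MulAut.conjNormal h x) = ψ x)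
    (h2 : ∀ x : N, (x : G) = h * h → ψ x = 1) :
    ∃ F : G →* ℤˣ, ∀ x : N, F x = ψ x := by
  classical
  have hmem : ∀ a b, a * b ∈ N ↔ (a ∈ N ↔ b ∈ N) := fun a b =>
    Subgroup.mul_mem_iff_of_index_two hi
  have hq : ∀ a, a ∉ N → a * h⁻¹ ∈ N := fun a ha => by simp [hmem, ha, hh]
  refine ⟨⟨⟨fun g => if hg : g ∈ N then ψ ⟨g, hg⟩ else ψ ⟨g * h⁻¹, hq g hg⟩, ?_⟩, ?_⟩, ?_⟩
  · rw [dif_pos N.one_mem]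
    exact map_one ψ
  · intro a b
    by_cases ha : a ∈ N <;> by_cases hb : b ∈ N
    · have hab : a * b ∈ N := N.mul_mem ha hb
      simp only [ha, hb, hab, dif_pos, ← map_mul]
      rfl
    · have hab : a * b ∉ N := by simp [hmem, ha, hb]
      simp only [ha, hb, hab, dif_pos, dif_neg, not_false_eq_true, ← map_mul]
      congr 1
      ext
      simp [mul_assoc]
    · have hab : a * b ∉ N := by simp [hmem, ha, hb]
      simp only [ha, hb, hab, dif_pos, dif_neg, not_false_eq_true]
      rw [← hc ⟨b, hb⟩, ← map_mul]
      congr 1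
      ext
      simp [mul_assoc]
    · have hab : a * b ∈ N := by simp [hmem, ha, hb]
      simp only [ha, hb, hab, dif_pos, dif_neg, not_false_eq_true]
      have hhN : h * h ∈ N := by simp [hmem, hh]
      rw [← hc ⟨b * h⁻¹, hq b hb⟩, ← mul_one (ψ _ * _), ← h2 ⟨h * h, hhN⟩ rfl, ← map_mul, ← map_mul]
      congr 1
      ext
      simp [mul_assoc]
  · intro x
    exact dif_pos x.2

/-- This is the transfer of `φ`. Conjugation by `h * h` is inner in `N`, so the product is invariant
under `h`; at `h * h` it is a square in `ℤˣ`. -/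
theorem exists_sign_transfer {N : Subgroup G} [hN : N.Normal] (hi : N.index = 2) {h : G}
    (hh : h ∉ N) (φ : N →* ℤˣ) :
    ∃ F : G →* ℤˣ, ∀ x : N, F x = φ x * φ (MulAut.conjNormal h x) := by
  have hhN : h * h ∈ N := (Subgroup.mul_mem_iff_of_index_two hi).2 Iff.rfl
  refine exists_sign_extension hi hh (φ * φ.comp (MulAut.conjNormal h : N ≃* N).toMonoidHom) ?_ ?_
  · intro x
    have : MulAut.conjNormal h (MulAut.conjNormal h x) = ⟨h * h, hhN⟩ * x * ⟨h * h, hhN⟩⁻¹ := by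
      ext
      simp [mul_assoc]
    simp only [MonoidHom.mul_apply, MonoidHom.comp_apply, MulEquiv.coe_toMonoidHom]
    rw [this, map_mul, map_mul, map_inv, mul_inv_cancel_comm, mul_comm]
  · intro x hx
    have : MulAut.conjNormal h x = x := by
      ext
      simp [hx, mul_assoc]
    simp only [MonoidHom.mul_apply, MonoidHom.comp_apply, MulEquiv.coe_toMonoidHom, this]
    exact Int.units_mul_self _

end Extension

/-! ### The inductive step from `A` to subgroups of `A ≀ C_2` -/

section Step

variable {A G : Type*} [Group A] [Group G]

/-- Case of a subgroup of `A × A`: generators of the image under `p` and of the kernel of `p`, seen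
through `q`, add up. Signs of `q.range` pull back to `G`, so the Frattini saving applies to the
kernel part. -/
theorem rankGood_of_pair {m : ℕ} (hA : HereditarilyRankGood m A) (p q : G →* A)
    (hpq : ∀ x, p x = 1 → q x = 1 → x = 1) : RankGood (2 * m + 1) G := by
  have hinj : ∀ K : Subgroup G, ∀ x ∈ K ⊓ p.ker, q x = 1 → x = 1 := fun K x hx => hpq x hx.2
  refine ⟨?_, fun K hK hf => ?_⟩
  · exact ((hA.genBy _).of_map_of_inf_ker p ((hA.genBy _).of_map q (hinj ⊤))).mono (by omega)
  · have h1 : GenBy m ((K ⊓ p.ker).map q) := hA.genBy_map q _ inferInstance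
      fun f k hk => hf (f.comp q.rangeRestrict) k hk.1
    exact ((hA.genBy _).of_map_of_inf_ker p (h1.of_map q (hinj K))).mono (by omega)

theorem rankGood_of_index_two [Finite A] (h2A : IsPGroup 2 A) {m : ℕ}
    (hA : HereditarilyRankGood m A) {N : Subgroup G} [hN : N.Normal] (hi : N.index = 2) {h : G}
    (hh : h ∉ N) (p : N →* A)
    (hp : ∀ x, p x = 1 → p (MulAut.conjNormal h x) = 1 → x = 1) : RankGood (2 * m + 1) G := by
  classical
  set c : N →* N := (MulAut.conjNormal h : N ≃* N).toMonoidHom with hcdef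
  have hcs : Function.Surjective c := (MulAut.conjNormal h : N ≃* N).surjective
  have hinj : ∀ K : Subgroup N, ∀ x ∈ K ⊓ p.ker, (p.comp c) x = 1 → x = 1 := fun K x hx => hp x hx.2
  refine ⟨?_, fun K hK hf => ?_⟩
  · have hgen : ∀ S : Finset G, (h ∈ Subgroup.closure (S : Set G)) →
        N ≤ Subgroup.closure (S : Set G) → Subgroup.closure (S : Set G) = ⊤ := by
      intro S hS hNS
      rw [eq_top_iff]
      intro x _
      by_cases hx : x ∈ N
      · exact hNS hx
      · have : x * h⁻¹ ∈ N := by simp [Subgroup.mul_mem_iff_of_index_two hi, hx, hh]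
        simpa using Subgroup.mul_mem _ (hNS this) hS
    -- If the conjugate of `p.ker` maps into the Frattini subgroup of `p.range`, then `p.ker` needs
    -- only `m` generators and the total is `1 + (m + 1) + m`.
    by_cases hkill : ∀ f : p.range →* ℤˣ, ∀ k ∈ p.ker.map c, f (p.rangeRestrict k) = 1
    · have h1 := hA.genBy_map p (p.ker.map c) (Subgroup.Normal.map inferInstance c hcs) hkill
      rw [Subgroup.map_map] at h1
      have h3 : GenBy m (⊤ ⊓ p.ker) := by
        rw [top_inf_eq]
        exact h1.of_map _ fun x hx => hp x hx
      obtain ⟨S, hS, hSc⟩ := ((hA.genBy _).of_map_of_inf_ker p h3).map N.subtype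
      rw [← MonoidHom.range_eq_map, Subgroup.range_subtype] at hSc
      refine ⟨insert h S, (Finset.card_insert_le _ _).trans (by omega), hgen _ ?_ ?_⟩
      · exact Subgroup.subset_closure (by simp)
      · conv_lhs => rw [← hSc]
        exact Subgroup.closure_mono (by simp)
    -- Otherwise some `p (c l)` with `l ∈ p.ker` belongs to a generating set of `p.range` with `m`
    -- further elements. As `c l` is the conjugate of `l` by `h`, it comes free, and the total is `1
    -- + m + (m + 1)`.
    · push Not at hkill
      obtain ⟨f, _, ⟨l, hl, rfl⟩, hfk⟩ := hkill
      obtain ⟨S', hS', hc'⟩ := (hA p.range).1.exchange (h2A.to_subgroup _) _ f hfk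
      obtain ⟨S, hS, -, hfS⟩ := exists_finset_lift p.rangeRestrict ⊤ S' (by
        rw [Subgroup.map_top_of_surjective _ p.rangeRestrict_surjective]
        simp)
      obtain ⟨T, hT, hTc⟩ := (hA.genBy _).of_map (p.comp c) (H := p.ker) (fun x hx => hp x hx)
      let U : Finset G := insert h ((S ∪ T).image N.subtype)
      have hhU : h ∈ Subgroup.closure (U : Set G) := Subgroup.subset_closure (by simp [U])
      have hU : ∀ x ∈ S ∪ T, (x : G) ∈ Subgroup.closure (U : Set G) := fun x hx =>
        Subgroup.subset_closure (by
          simp only [U, Finset.coe_insert, Finset.coe_image]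
          exact Or.inr ⟨x, hx, rfl⟩)
      have hker : p.rangeRestrict.ker ≤ (Subgroup.closure (U : Set G)).subgroupOf N := by
        rw [MonoidHom.ker_rangeRestrict, ← hTc, Subgroup.closure_le]
        intro x hx
        exact hU x (Finset.mem_union_right _ hx)
      refine ⟨U, ?_, hgen U hhU ?_⟩
      · refine (Finset.card_insert_le _ _).trans ?_
        have := Finset.card_image_le (s := S ∪ T) (f := N.subtype)
        have := Finset.card_union_le S T
        omega
      · rw [← Subgroup.subgroupOf_eq_top, eq_top_iff]
        refine le_of_map_le_of_inf_ker_le (f := p.rangeRestrict) le_top ?_ (by simpa using hker)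
        refine le_top.trans ?_
        rw [← hc', Subgroup.closure_le, Set.insert_subset_iff]
        constructor
        · refine ⟨c l, ?_, rfl⟩
          have hl' : (l : G) ∈ Subgroup.closure (U : Set G) := by
            have : l ∈ p.rangeRestrict.ker := by rwa [MonoidHom.ker_rangeRestrict]
            exact hker this
          have : h * (l : G) * h⁻¹ ∈ Subgroup.closure (U : Set G) :=
            Subgroup.mul_mem _ (Subgroup.mul_mem _ hhU hl') (Subgroup.inv_mem _ hhU)
          simpa [Subgroup.mem_subgroupOf, hcdef] using this
        · rw [← hfS]
          rintro _ ⟨x, hx, rfl⟩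
          exact ⟨x, hU x (Finset.mem_union_left _ hx), rfl⟩
  · have hKN : K ≤ N := by
      obtain ⟨f, hf'⟩ := exists_sign_of_index_two hi
      exact fun x hx => (hf' x).1 (hf f x hx)
    have hKn : (K.subgroupOf N).Normal := inferInstance
    have h1 : GenBy m (((K.subgroupOf N ⊓ p.ker).map c).map p) := by
      refine hA.genBy_map p _ (Subgroup.Normal.map inferInstance c hcs) ?_
      rintro f _ ⟨l, hl, rfl⟩
      -- The transferred sign kills `K`, and on `p.ker` its first factor is trivial; so the second
      -- factor, the sign of the conjugate, is trivial too.
      obtain ⟨F, hF⟩ := exists_sign_transfer hi hh (f.comp p.rangeRestrict)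
      have h1 := hF l
      have h3 : p.rangeRestrict l = 1 := by
        ext
        exact hl.2
      rw [hf F l hl.1, MonoidHom.comp_apply, h3, map_one, one_mul] at h1
      exact h1.symm
    rw [Subgroup.map_map] at h1
    have h3 := ((hA.genBy _).of_map_of_inf_ker p
      (h1.of_map _ (hinj _))).map N.subtype
    rw [Subgroup.map_subgroupOf_eq_of_le hKN] at h3
    exact h3.mono (by omega)

theorem HereditarilyRankGood.step [Finite A] (h2A : IsPGroup 2 A) {m : ℕ}
    (hA : HereditarilyRankGood m A) {N : Subgroup G} [hN : N.Normal] (hi : N.index = 2)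
    (p : N →* A)
    (hp : ∀ h ∉ N, ∀ x, p x = 1 → p (MulAut.conjNormal h x) = 1 → x = 1) :
    HereditarilyRankGood (2 * m + 1) G := by
  intro B
  by_cases hBN : B ≤ N
  · obtain ⟨h, hh⟩ : ∃ h, h ∉ N := by
      by_contra! hcon
      have : N = ⊤ := eq_top_iff.2 fun x _ => hcon x
      rw [this, Subgroup.index_top] at hi
      omega
    refine rankGood_of_pair hA (p.comp (Subgroup.inclusion hBN))
      ((p.comp (MulAut.conjNormal h : N ≃* N).toMonoidHom).comp (Subgroup.inclusion hBN)) ?_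
    intro x h1 h2
    exact Subgroup.inclusion_injective hBN ((hp h hh _ h1 h2).trans (map_one _).symm)
  · obtain ⟨h, hhB, hh⟩ := Set.not_subset.1 hBN
    have hh : h ∉ N := hh
    have hi' : (N.subgroupOf B).index = 2 := by
      rw [Subgroup.index_eq_two_iff_exists_notMem_and]
      refine ⟨⟨h, hhB⟩, hh, fun b => ?_⟩
      simp only [Subgroup.mem_subgroupOf, Subgroup.coe_mul,
        Subgroup.mul_mem_iff_of_index_two hi, hh, iff_false]
      exact (em _).symm
    let j : N.subgroupOf B →* N := (B.subtype.comp (N.subgroupOf B).subtype).codRestrict N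
      fun x => x.2
    refine rankGood_of_index_two h2A hA hi' (h := ⟨h, hhB⟩) hh (p.comp j) ?_
    intro x h1 h2
    have h3 := hp h hh (j x) h1 (by
      rw [← h2, MonoidHom.comp_apply]
      congr 1)
    have h4 : ((j x : N) : G) = ((1 : N) : G) := by rw [h3]
    exact Subtype.ext (Subtype.ext h4)

end Step

/-! ### The semidihedral group: finiteness and the case `m = 1` -/

section Semidihedral

variable {c : ℕ}

theorem semidihedral_x_sq : (PresentedGroup.of SDGen.x : Semidihedral c) ^ 2 = 1 :=
  PresentedGroup.one_of_mem (rels := semidihedralRels c) (x := FreeGroup.of SDGen.x ^ 2)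
    (by simp [semidihedralRels])

theorem semidihedral_y_pow : (PresentedGroup.of SDGen.y : Semidihedral c) ^ 2 ^ c = 1 :=
  PresentedGroup.one_of_mem (rels := semidihedralRels c) (x := FreeGroup.of SDGen.y ^ 2 ^ c)
    (by simp [semidihedralRels])

theorem semidihedral_conj : (PresentedGroup.of SDGen.x : Semidihedral c)⁻¹ *
    PresentedGroup.of SDGen.y * PresentedGroup.of SDGen.x =
      PresentedGroup.of SDGen.y ^ (-(1 + 2 ^ (c - 1)) : ℤ) :=
  mul_inv_eq_one.1 <| PresentedGroup.one_of_mem (rels := semidihedralRels c)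
    (x := (FreeGroup.of SDGen.x)⁻¹ * FreeGroup.of SDGen.y * FreeGroup.of SDGen.x *
      (FreeGroup.of SDGen.y ^ (-(1 + 2 ^ (c - 1)) : ℤ))⁻¹) (by simp [semidihedralRels])

theorem semidihedral_x_mul_zpow (l : ℤ) : (PresentedGroup.of SDGen.x : Semidihedral c) *
    PresentedGroup.of SDGen.y ^ l =
      PresentedGroup.of SDGen.y ^ (-(1 + 2 ^ (c - 1)) * l : ℤ) * PresentedGroup.of SDGen.x := by
  have hx : (PresentedGroup.of SDGen.x : Semidihedral c)⁻¹ = PresentedGroup.of SDGen.x :=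
    inv_eq_of_mul_eq_one_left (by rw [← sq, semidihedral_x_sq])
  have h := conj_zpow (i := l) (a := (PresentedGroup.of SDGen.x : Semidihedral c))
    (b := PresentedGroup.of SDGen.y)
  have h2 := semidihedral_conj (c := c)
  rw [hx] at h h2
  rw [h2, ← zpow_mul] at h
  rw [h, mul_assoc, ← sq, semidihedral_x_sq, mul_one]

theorem semidihedral_normal_form (g : Semidihedral c) :
    ∃ k : ℤ, g = PresentedGroup.of SDGen.y ^ k ∨
      g = PresentedGroup.of SDGen.y ^ k * PresentedGroup.of SDGen.x := by
  have hx : (PresentedGroup.of SDGen.x : Semidihedral c) * PresentedGroup.of SDGen.x = 1 := by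
    rw [← sq, semidihedral_x_sq]
  have hg : g ∈ Subgroup.closure (Set.range (PresentedGroup.of (rels := semidihedralRels c))) := by
    rw [PresentedGroup.closure_range_of]
    trivial
  induction hg using Subgroup.closure_induction with
  | mem x hx =>
    obtain ⟨_ | _, rfl⟩ := hx
    · exact ⟨0, Or.inr (by simp)⟩
    · exact ⟨1, Or.inl (by simp)⟩
  | one => exact ⟨0, Or.inl (by simp)⟩
  | mul a b _ _ ha hb =>
    obtain ⟨k, rfl | rfl⟩ := ha <;> obtain ⟨l, rfl | rfl⟩ := hb
    · exact ⟨k + l, Or.inl (zpow_add _ _ _).symm⟩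
    · exact ⟨k + l, Or.inr (by rw [zpow_add, mul_assoc])⟩
    · exact ⟨k + -(1 + 2 ^ (c - 1)) * l, Or.inr (by
        rw [mul_assoc, semidihedral_x_mul_zpow, zpow_add, mul_assoc])⟩
    · refine ⟨k + -(1 + 2 ^ (c - 1)) * l, Or.inl ?_⟩
      rw [mul_assoc, ← mul_assoc (PresentedGroup.of SDGen.x), semidihedral_x_mul_zpow, mul_assoc,
        hx, mul_one, zpow_add]
  | inv a _ ha =>
    obtain ⟨k, rfl | rfl⟩ := ha
    · exact ⟨-k, Or.inl (zpow_neg _ _).symm⟩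
    · exact ⟨-(1 + 2 ^ (c - 1)) * (-k), Or.inr (by
        rw [← semidihedral_x_mul_zpow, mul_inv_rev, zpow_neg, inv_eq_of_mul_eq_one_left hx])⟩

/-- The sign homomorphism with kernel `⟨y⟩`. -/
theorem exists_semidihedral_sign (c : ℕ) :
    ∃ f : Semidihedral c →* ℤˣ, f.ker ≤ Subgroup.zpowers (PresentedGroup.of SDGen.y) := by
  let φ : SDGen → ℤˣ := fun s => SDGen.casesOn s (-1) 1
  have hφ : ∀ r ∈ semidihedralRels c, FreeGroup.lift φ r = 1 := by
    rintro r (rfl | rfl | rfl) <;> simp [φ]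
  refine ⟨PresentedGroup.toGroup hφ, fun g hg => ?_⟩
  obtain ⟨k, rfl | rfl⟩ := semidihedral_normal_form g
  · exact ⟨k, rfl⟩
  · exfalso
    simp [MonoidHom.mem_ker, φ] at hg

instance (c : ℕ) : Finite (Semidihedral c) := by
  have h1 : IsOfFinOrder (PresentedGroup.of SDGen.y : Semidihedral c) :=
    isOfFinOrder_iff_pow_eq_one.2 ⟨2 ^ c, by positivity, semidihedral_y_pow⟩
  have : Finite (Subgroup.zpowers (PresentedGroup.of SDGen.y : Semidihedral c)) :=
    h1.finite_zpowers
  refine Finite.of_surjective (α := Subgroup.zpowers (PresentedGroup.of SDGen.y : Semidihedral c) ×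
    Bool) (fun p => p.1.1 * cond p.2 (PresentedGroup.of SDGen.x) 1) fun g => ?_
  obtain ⟨k, rfl | rfl⟩ := semidihedral_normal_form g
  · exact ⟨(⟨_, k, rfl⟩, false), by simp⟩
  · exact ⟨(⟨_, k, rfl⟩, true), by simp⟩

theorem isPGroup_semidihedral (c : ℕ) : IsPGroup 2 (Semidihedral c) := by
  intro g
  obtain ⟨f, hf⟩ := exists_semidihedral_sign c
  obtain ⟨k, hk⟩ := hf (x := g * g) (by
    rw [MonoidHom.mem_ker, map_mul]
    exact Int.units_mul_self _)
  -- The square of `g` lies in `⟨y⟩`, whose exponent divides `2 ^ c`.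
  refine ⟨c + 1, ?_⟩
  dsimp only at hk
  rw [pow_succ', pow_mul, sq, ← hk, ← zpow_natCast, zpow_comm, zpow_natCast, semidihedral_y_pow,
    one_zpow]

theorem genBy_one_of_isCyclic {G : Type*} [Group G] {H : Subgroup G} (h : IsCyclic H) :
    GenBy 1 H := by
  obtain ⟨g, rfl⟩ := (Subgroup.isCyclic_iff_exists_zpowers_eq_top H).1 h
  exact ⟨{g}, by simp, by simp [Subgroup.zpowers_eq_closure]⟩

theorem genBy_one_of_le_of_isCyclic {G : Type*} [Group G] {H K : Subgroup G} (hHK : H ≤ K)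
    [IsCyclic K] : GenBy 1 H := by
  have := (genBy_one_of_isCyclic (H := H.subgroupOf K) inferInstance).map K.subtype
  rwa [Subgroup.map_subgroupOf_eq_of_le hHK] at this

/-- Each subgroup is cyclic by cyclic, and anything killed by all signs falls into the cyclic group
`⟨y⟩`. -/
theorem hereditarilyRankGood_semidihedral (c : ℕ) : HereditarilyRankGood 1 (Semidihedral c) := by
  intro H
  obtain ⟨f, hf⟩ := exists_semidihedral_sign c
  have key : ∀ K : Subgroup H, K ≤ (f.comp H.subtype).ker → GenBy 1 K := by
    intro K hK
    refine GenBy.of_map H.subtype (genBy_one_of_le_of_isCyclic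
      (K := Subgroup.zpowers (PresentedGroup.of SDGen.y)) ?_) fun x _ hx => Subtype.ext hx
    rintro _ ⟨k, hk, rfl⟩
    exact hf (hK hk)
  refine ⟨?_, fun K _ hK => key K fun k hk => hK _ k hk⟩
  exact (genBy_one_of_isCyclic inferInstance).of_map_of_inf_ker (f.comp H.subtype)
    (key _ inf_le_right)

end Semidihedral

theorem HereditarilyRankGood.of_injective {A G : Type*} [Group A] [Group G] {m : ℕ}
    (hA : HereditarilyRankGood m A) (f : G →* A) (hf : Function.Injective f) :
    HereditarilyRankGood m G := by
  intro H
  have hinj : ∀ x : H, (f.comp H.subtype) x = 1 → x = 1 := fun x hx =>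
    Subtype.ext (hf (hx.trans (map_one f).symm))
  exact ⟨(hA.genBy _).of_map (f.comp H.subtype) fun x _ => hinj x, fun K hK h =>
    (hA.genBy_map (f.comp H.subtype) K hK fun φ k hk => h (φ.comp _) k hk).of_map _
      fun x _ => hinj x⟩

/-! ### Block structure of the iterated wreath product -/

section Wreath

/-- The cyclic group of order two used for the wreath products. -/
abbrev CTwo : Type := Multiplicative (ZMod 2)

/-- The point of `Fin (r + 1) → C₂` with initial part `ω` and last coordinate `q`. -/
def blockPoint {r : ℕ} (ω : Fin r → CTwo) (q : CTwo) : Fin (r + 1) → CTwo :=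
  (Fin.succFunEquiv CTwo r).symm (ω, q)

theorem exists_blockPoint {r : ℕ} (p : Fin (r + 1) → CTwo) : ∃ ω q, blockPoint ω q = p :=
  ⟨_, _, (Fin.succFunEquiv CTwo r).symm_apply_apply p⟩

/-- The image of `w` in the top `C₂`. -/
def wTop {r : ℕ} (w : WTwo (r + 1)) : CTwo := RegularWreathProduct.right w

/-- The coordinates of `w` in the base group. -/
def wBase {r : ℕ} (w : WTwo (r + 1)) (q : CTwo) : WTwo r := RegularWreathProduct.left w q

theorem wBase_mul {r : ℕ} (v w : WTwo (r + 1)) (q : CTwo) :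
    wBase (v * w) q = wBase v q * wBase w ((wTop v)⁻¹ * q) := rfl

theorem wTwo_ext {r : ℕ} {v w : WTwo (r + 1)} (h1 : ∀ q, wBase v q = wBase w q)
    (h2 : wTop v = wTop w) : v = w := RegularWreathProduct.ext (funext h1) h2

theorem perm_blockPoint {r : ℕ} (w : WTwo (r + 1)) (ω : Fin r → CTwo) (q : CTwo) :
    iteratedWreathToPermHom CTwo (r + 1) w (blockPoint ω q) =
      blockPoint (iteratedWreathToPermHom CTwo r (wBase w (wTop w * q)) ω) (wTop w * q) := by
  let _ := MulAction.compHom (Fin r → CTwo) (iteratedWreathToPermHom CTwo r)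
  change (Fin.succFunEquiv CTwo r).symm (RegularWreathProduct.toPerm (WTwo r) CTwo (Fin r → CTwo) w
    ((Fin.succFunEquiv CTwo r) ((Fin.succFunEquiv CTwo r).symm (ω, q)))) = _
  rw [Equiv.apply_symm_apply]
  rfl

variable {c r : ℕ}

theorem yGroup_left_mul (g h : YGroup c r) (p : Fin r → CTwo) :
    (g * h).left p =
      g.left p * h.left ((iteratedWreathToPermHom CTwo r g.right)⁻¹ p) := rfl

/-- The projection of `Y_{c,r+1}` to the top `C₂`. -/
def yTop (c r : ℕ) : YGroup c (r + 1) →* CTwo where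
  toFun g := wTop g.right
  map_one' := rfl
  map_mul' _ _ := rfl

theorem perm_inv_blockPoint {w : WTwo (r + 1)} (hw : wTop w = 1) (ω : Fin r → CTwo) (q : CTwo) :
    (iteratedWreathToPermHom CTwo (r + 1) w)⁻¹ (blockPoint ω q) =
      blockPoint ((iteratedWreathToPermHom CTwo r (wBase w q))⁻¹ ω) q := by
  rw [Equiv.Perm.inv_eq_iff_eq, perm_blockPoint, hw, one_mul]
  simp

/-- The block stabilizer acts on the block with last coordinate `1`. -/
def yBlock (c r : ℕ) : (yTop c r).ker →* YGroup c r where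
  toFun g := ⟨fun ω => g.1.left (blockPoint ω 1), wBase g.1.right 1⟩
  map_one' := rfl
  map_mul' g h := by
    have hg : wTop g.1.right = 1 := g.2
    refine SemidirectProduct.ext (funext fun ω => ?_) ?_
    · rw [yGroup_left_mul]
      change (g.1 * h.1).left _ = _
      rw [yGroup_left_mul, perm_inv_blockPoint hg]
    · change wBase (g.1.right * h.1.right) 1 = wBase g.1.right 1 * wBase h.1.right 1
      rw [wBase_mul, hg, inv_one, one_mul]

theorem CTwo.mul_eq_one {a b : CTwo} (ha : a ≠ 1) (hb : b ≠ 1) : a * b = 1 := by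
  revert a b
  decide

theorem index_ker_yTop (c r : ℕ) : (yTop c r).ker.index = 2 := by
  have h : Function.Surjective (yTop c r) := fun q =>
    ⟨⟨1, (RegularWreathProduct.inl q : RegularWreathProduct (WTwo r) CTwo)⟩, rfl⟩
  rw [Subgroup.index_ker, MonoidHom.range_eq_top.2 h]
  simp

/-- An element outside the block stabilizer swaps the two blocks, so the action of `x` on the other
block is read off from its conjugate on block `1`. -/
theorem yBlock_jointly_injective (h : YGroup c (r + 1)) (hh : h ∉ (yTop c r).ker)
    (x : (yTop c r).ker) (h1 : yBlock c r x = 1)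
    (h2 : yBlock c r (MulAut.conjNormal h x) = 1) : x = 1 := by
  set y := MulAut.conjNormal h x with hy
  have hyx : y.1 * h = h * x.1 := by
    rw [hy, MulAut.conjNormal_apply, inv_mul_cancel_right]
  have hl : ∀ z : (yTop c r).ker, yBlock c r z = 1 → ∀ ω, z.1.left (blockPoint ω 1) = 1 :=
    fun z hz ω => congrFun (congrArg SemidirectProduct.left hz) ω
  have hr : ∀ z : (yTop c r).ker, yBlock c r z = 1 → wBase z.1.right 1 = 1 :=
    fun z hz => congrArg SemidirectProduct.right hz
  have hxt : wTop x.1.right = 1 := x.2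
  have hyt : wTop y.1.right = 1 := y.2
  have hht : wTop h.right ≠ 1 := hh
  have hleft : ∀ p, (y.1 * h).left p = (h * x.1).left p := fun p => by rw [hyx]
  have hright : y.1.right * h.right = h.right * x.1.right := congrArg SemidirectProduct.right hyx
  have hinv : ∀ (σ : Equiv.Perm (Fin (r + 1) → CTwo)) p, σ⁻¹ (σ p) = p :=
    fun σ => σ.symm_apply_apply
  refine Subtype.ext (SemidirectProduct.ext (funext fun p => ?_) (wTwo_ext (fun q => ?_) hxt))
  · obtain ⟨ω, q, rfl⟩ := exists_blockPoint p
    by_cases hq : q = 1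
    · rw [hq]
      exact hl x h1 ω
    · have h3 := hleft (iteratedWreathToPermHom CTwo (r + 1) h.right (blockPoint ω q))
      rw [yGroup_left_mul, yGroup_left_mul, hinv, perm_blockPoint,
        CTwo.mul_eq_one hht hq, perm_inv_blockPoint hyt, hr y h2, map_one, inv_one,
        Equiv.Perm.one_apply, hl y h2, one_mul] at h3
      exact (mul_eq_left.1 h3.symm)
  · by_cases hq : q = 1
    · rw [hq]
      exact hr x h1
    · have h3 := congrArg (fun w => wBase w 1) hright
      simp only [wBase_mul] at h3
      rw [hr y h2, hyt, one_mul, inv_one, one_mul, mul_one,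
        inv_eq_of_mul_eq_one_right (CTwo.mul_eq_one hht hq)] at h3
      exact mul_eq_left.1 h3.symm

instance (c r : ℕ) : Finite (YGroup c r) :=
  Finite.of_equiv _ SemidirectProduct.equivProd.symm

theorem isPGroup_yGroup (c r : ℕ) : IsPGroup 2 (YGroup c r) := by
  have : Fact (Nat.Prime 2) := ⟨Nat.prime_two⟩
  obtain ⟨n, hn⟩ := IsPGroup.iff_card.1 (isPGroup_semidihedral c)
  have h2 : Nat.card CTwo = 2 := by simp
  -- The base group contributes `n * 2 ^ r` to the exponent of the order, `W_r(2)` the geometric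
  -- sum.
  refine IsPGroup.of_card (n := n * 2 ^ r + ∑ i ∈ Finset.range r, 2 ^ i) ?_
  rw [SemidirectProduct.card, Nat.card_fun, hn, Nat.card_fun, h2, Nat.card_fin,
    IteratedWreathProduct.card, h2, pow_add, pow_mul]

theorem hereditarilyRankGood_yGroup (c r : ℕ) :
    HereditarilyRankGood (2 ^ (r + 1) - 1) (YGroup c r) := by
  induction r with
  | zero =>
    have hinv : ∀ p : Fin 0 → CTwo, p = default := fun p => Subsingleton.elim _ _
    refine (hereditarilyRankGood_semidihedral c).of_injective
      ⟨⟨fun g => g.left default, rfl⟩, fun g h => ?_⟩ fun g h hgh => ?_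
    · change (g * h).left default = g.left default * h.left default
      rw [yGroup_left_mul, hinv ((iteratedWreathToPermHom CTwo 0 g.right)⁻¹ default)]
    · refine SemidirectProduct.ext (funext fun p => ?_) rfl
      rw [hinv p]
      exact hgh
  | succ r ih =>
    have h := ih.step (isPGroup_yGroup c r) (index_ker_yTop c r) (yBlock c r)
      yBlock_jointly_injective
    have h1 : 1 ≤ 2 ^ (r + 1) := Nat.one_le_two_pow
    have : 2 ^ (r + 1 + 1) - 1 = 2 * (2 ^ (r + 1) - 1) + 1 := by
      rw [pow_succ 2 (r + 1)]
      omega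
    rwa [this]

end Wreath

/-! ### Passing to `minGenerators`, and the lower bound -/

section Generators

theorem GenBy.minGenerators_le {n : ℕ} {G : Type*} [Group G] (h : GenBy n (⊤ : Subgroup G)) :
    minGenerators G ≤ n := by
  obtain ⟨S, hS, hc⟩ := h
  refine (iInf₂_le (S : Set G) hc).trans ?_
  rw [Set.encard_coe_eq_coe_finsetCard]
  exact_mod_cast hS

theorem finrank_le_minGenerators {G V : Type*} [Group G] [AddCommGroup V] [Module (ZMod 2) V]
    (f : G →* Multiplicative V) (hf : Function.Surjective f) :
    (Module.finrank (ZMod 2) V : ℕ∞) ≤ minGenerators G := by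
  classical
  refine le_iInf₂ fun S hS => ?_
  by_cases hfin : S.Finite
  swap
  · rw [Set.Infinite.encard_eq hfin]
    exact le_top
  obtain ⟨T, rfl⟩ := hfin.exists_finset_coe
  rw [Set.encard_coe_eq_coe_finsetCard]
  have hspan : Submodule.span (ZMod 2)
      ((T.image fun g => (f g).toAdd : Finset V) : Set V) = ⊤ := by
    rw [eq_top_iff]
    intro v _
    obtain ⟨g, hg⟩ := hf (Multiplicative.ofAdd v)
    have hg' : (f g).toAdd = v := by rw [hg]; rfl
    rw [← hg']
    have hgS : g ∈ Subgroup.closure (T : Set G) := hS ▸ Subgroup.mem_top g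
    clear hg hg'
    induction hgS using Subgroup.closure_induction with
    | mem x hx => exact Submodule.subset_span (by simpa using ⟨x, hx, rfl⟩)
    | one => simp
    | mul a b _ _ ha hb => simpa using Submodule.add_mem _ ha hb
    | inv a _ ha => simpa using ha
  have h1 := finrank_span_finset_le_card (R := ZMod 2) (T.image fun g => (f g).toAdd)
  rw [Set.finrank, hspan, finrank_top] at h1
  exact_mod_cast h1.trans Finset.card_image_le

/-- The abelianization modulo squares of the semidihedral group. -/
theorem exists_semidihedral_surjective {c : ℕ} (hc : 3 ≤ c) :
    ∃ f : Semidihedral c →* Multiplicative (ZMod 2 × ZMod 2), Function.Surjective f := by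
  let φ : SDGen → Multiplicative (ZMod 2 × ZMod 2) := fun s =>
    SDGen.casesOn s (Multiplicative.ofAdd (1, 0)) (Multiplicative.ofAdd (0, 1))
  have hsq : ∀ v : Multiplicative (ZMod 2 × ZMod 2), v ^ 2 = 1 := by decide
  have hφ : ∀ r ∈ semidihedralRels c, FreeGroup.lift φ r = 1 := by
    -- With `c = d + 2`, the number `2 ^ (c - 1)` is even, so the conjugation exponent is odd and
    -- the relation becomes trivial in an elementary abelian 2-group.
    obtain ⟨d, rfl⟩ : ∃ d, c = d + 2 := ⟨c - 2, by omega⟩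
    rintro r (rfl | rfl | rfl)
    · simp [hsq]
    · rw [map_pow, FreeGroup.lift_apply_of, pow_succ', pow_mul, hsq, one_pow]
    · have h2 : φ SDGen.y ^ (2 : ℤ) ^ (d + 1) = 1 := by
        rw [pow_succ', zpow_mul]
        simp [hsq, zpow_ofNat]
      have h3 : φ SDGen.y ^ (-(1 + 2 ^ (d + 1)) : ℤ) = φ SDGen.y := by
        rw [zpow_neg, zpow_add, h2, zpow_one, mul_one]
        exact inv_eq_of_mul_eq_one_left (by rw [← sq, hsq])
      simp only [map_mul, map_inv, map_zpow, FreeGroup.lift_apply_of]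
      change _ * (φ SDGen.y ^ (-(1 + 2 ^ (d + 1)) : ℤ))⁻¹ = 1
      rw [h3]
      simp
  refine ⟨PresentedGroup.toGroup hφ, ?_⟩
  have h : ∀ v : Multiplicative (ZMod 2 × ZMod 2), ∃ a b : ℕ,
      φ SDGen.x ^ a * φ SDGen.y ^ b = v := by
    intro v
    have h4 : ∃ a b : Fin 2, φ SDGen.x ^ (a : ℕ) * φ SDGen.y ^ (b : ℕ) = v := by
      revert v
      decide
    obtain ⟨a, b, hab⟩ := h4
    exact ⟨a, b, hab⟩
  intro v
  obtain ⟨a, b, rfl⟩ := h v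
  exact ⟨PresentedGroup.of SDGen.x ^ a * PresentedGroup.of SDGen.y ^ b, by simp⟩

/-- The witness is the base group, which surjects coordinatewise onto `2 ^ r` copies of `C_2 × C_2`.
-/
theorem le_subgroupRank_yGroup {c : ℕ} (r : ℕ) (hc : 3 ≤ c) :
    (2 : ℕ∞) ^ (r + 1) ≤ subgroupRank (YGroup c r) := by
  obtain ⟨f, hf⟩ := exists_semidihedral_surjective hc
  let V := (Fin r → CTwo) → ZMod 2 × ZMod 2
  let i : ((Fin r → CTwo) → Semidihedral c) →* YGroup c r := SemidirectProduct.inl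
  let F : ((Fin r → CTwo) → Semidihedral c) →* Multiplicative V :=
    { toFun := fun u => Multiplicative.ofAdd fun ω => (f (u ω)).toAdd
      map_one' := congrArg Multiplicative.ofAdd
        (funext fun ω => congrArg Multiplicative.toAdd (map_one f))
      map_mul' := fun u v => congrArg Multiplicative.ofAdd
        (funext fun ω => congrArg Multiplicative.toAdd (map_mul f (u ω) (v ω))) }
  have hF : Function.Surjective F := fun v => by
    choose g hg using fun ω => hf (Multiplicative.ofAdd (v.toAdd ω))
    exact ⟨g, funext fun ω => congrArg Multiplicative.toAdd (hg ω)⟩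
  have hi : Function.Injective i := SemidirectProduct.inl_injective
  refine le_trans ?_ (le_iSup (fun H : Subgroup (YGroup c r) => minGenerators H) i.range)
  refine le_trans (le_of_eq ?_) (finrank_le_minGenerators
    (F.comp (MonoidHom.ofInjective hi).symm.toMonoidHom)
    (hF.comp (MonoidHom.ofInjective hi).symm.surjective))
  simp [V, Module.finrank_pi_fintype, pow_succ]

end Generators

theorem mainTheorem8 (c r : ℕ) (hc : 3 ≤ c) :
    subgroupRank (YGroup c r) = (2 : ℕ∞) ^ (r + 1) := by
  refine le_antisymm (iSup_le fun H => ?_) (le_subgroupRank_yGroup r hc)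
  have h := (hereditarilyRankGood_yGroup c r H).1.minGenerators_le
  rw [Nat.sub_add_cancel Nat.one_le_two_pow] at h
  exact_mod_cast h
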